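/- For a positive integer $v$ and a set $K$ of positive integers, a $(v,K,1)$ perfect difference family is a finite family $\mathcal F$ of subsets (base blocks) of $\mathbb Z_v=\mathbb Z/v\mathbb Z$ such that (1) $|B|\in K$ for every $B\in\mathcal F$; (2) every nonzero $d\in\mathbb Z_v$ has exactly one representation $d=x-y$ with $x,y\in B$, $x\ne y$, $B\in\mathcal F$; (3) every $B\in\mathcal F$ contains $0$, and every nonzero element of $B$ is the residue class of some integer $a$ with $1\le a\le\lfloor v/2\rfloor$. **Lemma.** For every integer $v\ge 59$ with $v\equiv 5\pmod 6$ there exists a $(v,\{3,4,5\},1)$ perfect difference family. -/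

import Mathlib

/-- `IsCDF v K F`: `F` is (the set of base blocks of) a `(v, K, 1)` cyclic difference family, i.e. a
family of subsets of `ℤ/v` with sizes in `K` such that each nonzero `d` in `ℤ/v` is exactly once
a difference `x - y` of two distinct elements `x, y` of a common block. -/
def IsCDF (v : ℕ) (K : Set ℕ) (F : Finset (Finset (ZMod v))) : Prop :=
  (∀ B ∈ F, B.card ∈ K) ∧
  ∀ d : ZMod v, d ≠ 0 →
    ∃! p : Finset (ZMod v) × ZMod v × ZMod v,
      p.1 ∈ F ∧ p.2.1 ∈ p.1 ∧ p.2.2 ∈ p.1 ∧ p.2.1 ≠ p.2.2 ∧ p.2.1 - p.2.2 = d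

/-- `IsPDF v K F`: `F` is a `(v, K, 1)` perfect difference family, i.e. a cyclic difference family
each of whose base blocks contains `0` and has its other elements among (the residue classes of)
`1, …, ⌊v / 2⌋`. -/
def IsPDF (v : ℕ) (K : Set ℕ) (F : Finset (Finset (ZMod v))) : Prop :=
  IsCDF v K F ∧
  ∀ B ∈ F, (0 : ZMod v) ∈ B ∧
    ∀ b ∈ B, b ≠ 0 → ∃ a : ℕ, 1 ≤ a ∧ a ≤ v / 2 ∧ (a : ZMod v) = b

/-!
A block of nonnegative integers is determined by its gaps, and its positive differences are the
sums of runs of consecutive gaps. For `v = 2 * n + 1` it suffices to find blocks whose positive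
differences are exactly `1, …, n`, each once: up to sign these are all the nonzero residues, and
there are `v - 1` of them, so no residue can be a difference twice.

Such blocks come from nested triples. When `a` climbs in steps of two while `b` descends in steps
of one, the blocks `{0, a, a + b}` have as differences one parity class of an interval and two full
intervals. Three nests of lengths `2 * t + 4`, `t` and `t` cover all of `1, …, 12 * t + 48 + r`
except a bounded number of values, affine in `t`. A bounded number of blocks with gaps affine in `t`
cover the rest; since only the coefficients of the affine functions matter, this is a finite check
for each of `r = 2, 5, 8, 11`. These blocks and the ones for `n < 50` were found by computer search.
-/

section GapLists

variable {α β : Type*} [AddMonoid α] [AddMonoid β]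

/-- The block `{0, a₁, a₁ + a₂, …}` whose consecutive elements have the given gaps. -/
def gapPoints : List α → List α
  | [] => [0]
  | a :: g => 0 :: (gapPoints g).map (a + ·)

/-- The sums of the nonempty runs of consecutive gaps, i.e. the differences `x - y` of the elements
`x` listed after `y` in the block `gapPoints g`. -/
def gapSums : List α → List α
  | [] => []
  | a :: g => (gapPoints g).map (a + ·) ++ gapSums g

theorem zero_mem_gapPoints (g : List α) : 0 ∈ gapPoints g := by
  cases g <;> exact List.mem_cons_self

theorem gapPoints_map (f : α →+ β) (g : List α) : gapPoints (g.map f) = (gapPoints g).map f := by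
  induction g with
  | nil => simp [gapPoints]
  | cons a g ih => simp [gapPoints, ih, Function.comp_def]

theorem gapSums_map (f : α →+ β) (g : List α) : gapSums (g.map f) = (gapSums g).map f := by
  induction g with
  | nil => rfl
  | cons a g ih => simp [gapSums, gapPoints_map, ih, Function.comp_def]

theorem flatMap_gapSums_map (f : α →+ β) (L : List (List α)) :
    (L.map (List.map f)).flatMap gapSums = (L.flatMap gapSums).map f := by
  simp only [List.flatMap_map, List.map_flatMap, gapSums_map]

theorem length_gapPoints (g : List α) : (gapPoints g).length = g.length + 1 := by
  induction g with
  | nil => rfl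
  | cons a g ih => simp [gapPoints, ih]

theorem two_mul_length_gapSums (g : List α) :
    2 * (gapSums g).length = (g.length + 1) * g.length := by
  induction g with
  | nil => rfl
  | cons a g ih =>
    simp only [gapSums, List.length_append, List.length_map, length_gapPoints, List.length_cons]
    linarith

theorem eq_zero_or_mem_gapSums {g : List α} {x : α} (hx : x ∈ gapPoints g) :
    x = 0 ∨ x ∈ gapSums g := by
  cases g with
  | nil => exact .inl (List.mem_singleton.1 hx)
  | cons a g => exact (List.mem_cons.1 hx).imp_right (List.mem_append_left _)

theorem exists_add_eq_of_mem_gapSums {g : List α} {d : α} (hd : d ∈ gapSums g) :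
    ∃ x ∈ gapPoints g, ∃ y ∈ gapPoints g, y + d = x := by
  induction g with
  | nil => cases hd
  | cons a g ih =>
    rcases List.mem_append.1 hd with hd | hd
    · exact ⟨d, List.mem_cons_of_mem _ hd, 0, List.mem_cons_self, zero_add d⟩
    · obtain ⟨x, hx, y, hy, rfl⟩ := ih hd
      exact ⟨a + (y + d), List.mem_cons_of_mem _ (List.mem_map_of_mem hx), a + y,
        List.mem_cons_of_mem _ (List.mem_map_of_mem hy), add_assoc a y d⟩

theorem nodup_gapPoints [IsLeftCancelAdd α] {g : List α} (h : 0 ∉ gapSums g) :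
    (gapPoints g).Nodup := by
  induction g with
  | nil => exact List.nodup_singleton 0
  | cons a g ih =>
    rw [gapSums, List.mem_append, not_or] at h
    exact List.nodup_cons.2 ⟨h.1, (ih h.2).map (add_right_injective a)⟩

end GapLists

section CyclicDifferenceFamilies

theorem sum_toFinset_le_sum_map {ι M : Type*} [DecidableEq ι] [AddCommMonoid M] [PartialOrder M]
    [IsOrderedAddMonoid M] [CanonicallyOrderedAdd M] (l : List ι) (f : ι → M) :
    ∑ i ∈ l.toFinset, f i ≤ (l.map f).sum := by
  have dedup_eq : l.dedup.toFinset = l.toFinset := by ext; simp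
  rw [← dedup_eq, List.sum_toFinset f l.nodup_dedup]
  exact ((List.dedup_sublist l).map f).sum_le_sum fun _ _ => zero_le

variable {v : ℕ} {K : Set ℕ}

theorem isCDF_of_sum_card_offDiag_lt {F : Finset (Finset (ZMod v))} (hK : ∀ B ∈ F, B.card ∈ K)
    (hcover : ∀ d : ZMod v, d ≠ 0 → ∃ B ∈ F, ∃ x ∈ B, ∃ y ∈ B, x - y = d)
    (hcard : ∑ B ∈ F, B.offDiag.card < v) : IsCDF v K F := by
  have : NeZero v := .of_gt hcard
  let S : Finset (Finset (ZMod v) × ZMod v × ZMod v) := F.biUnion fun B => B.offDiag.image (B, ·)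
  have mem_S (p) : p ∈ S ↔ p.1 ∈ F ∧ p.2.1 ∈ p.1 ∧ p.2.2 ∈ p.1 ∧ p.2.1 ≠ p.2.2 := by
    obtain ⟨B, x, y⟩ := p
    simp only [S, Finset.mem_biUnion, Finset.mem_image, Finset.mem_offDiag]
    aesop
  let diff : Finset (ZMod v) × ZMod v × ZMod v → ZMod v := fun p => p.2.1 - p.2.2
  have surj : Set.SurjOn diff S (Finset.univ.erase 0 : Finset (ZMod v)) := by
    intro d hd
    have hd0 : d ≠ 0 := by simpa using hd
    obtain ⟨B, hB, x, hx, y, hy, rfl⟩ := hcover d hd0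
    exact ⟨(B, x, y), (mem_S _).2 ⟨hB, hx, hy, sub_ne_zero.1 hd0⟩, rfl⟩
  have card_S : S.card ≤ (Finset.univ.erase (0 : ZMod v)).card := by
    rw [Finset.card_erase_of_mem (Finset.mem_univ _), Finset.card_univ, ZMod.card]
    calc S.card ≤ ∑ B ∈ F, (B.offDiag.image (B, ·)).card := Finset.card_biUnion_le
      _ ≤ ∑ B ∈ F, B.offDiag.card := Finset.sum_le_sum fun _ _ => Finset.card_image_le
      _ ≤ v - 1 := Nat.le_sub_one_of_lt hcard
  have inj : Set.InjOn diff S := by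
    refine Finset.injOn_of_surjOn_of_card_le _ (fun p hp => ?_) surj card_S
    simpa [diff, sub_eq_zero] using ((mem_S p).1 hp).2.2.2
  refine ⟨hK, fun d hd => ?_⟩
  obtain ⟨p, hp, rfl⟩ := surj (show d ∈ _ by simpa using hd)
  obtain ⟨hpF, hx, hy, hne⟩ := (mem_S p).1 hp
  exact ⟨p, ⟨hpF, hx, hy, hne, rfl⟩,
    fun q ⟨hqF, hx', hy', hne', hq⟩ => inj ((mem_S q).2 ⟨hqF, hx', hy', hne'⟩) hp hq⟩

/-- The family of the blocks with the given gap lists. -/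
def gapBlocks {α : Type*} [AddMonoid α] [DecidableEq α] (L : List (List α)) : Finset (Finset α) :=
  (L.map fun g => (gapPoints g).toFinset).toFinset

theorem mem_gapBlocks {α : Type*} [AddMonoid α] [DecidableEq α] {L : List (List α)}
    {B : Finset α} : B ∈ gapBlocks L ↔ ∃ g ∈ L, (gapPoints g).toFinset = B := by
  simp [gapBlocks]

theorem sum_card_offDiag_gapBlocks_le {α : Type*} [AddMonoid α] [DecidableEq α]
    (L : List (List α)) :
    ∑ B ∈ gapBlocks L, B.offDiag.card ≤ 2 * (L.flatMap gapSums).length := by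
  have card_offDiag_le (g : List α) :
      (gapPoints g).toFinset.offDiag.card ≤ 2 * (gapSums g).length := by
    have hcard : (gapPoints g).toFinset.card ≤ g.length + 1 :=
      (List.toFinset_card_le _).trans_eq (length_gapPoints g)
    rw [Finset.offDiag_card, ← Nat.mul_sub_one, two_mul_length_gapSums]
    exact Nat.mul_le_mul hcard (Nat.sub_le_of_le_add hcard)
  calc ∑ B ∈ gapBlocks L, B.offDiag.card
      ≤ (L.map fun g => (gapPoints g).toFinset.offDiag.card).sum := by
        simpa only [gapBlocks, List.map_map, Function.comp_def] using
          sum_toFinset_le_sum_map (L.map fun g => (gapPoints g).toFinset) fun B => B.offDiag.card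
    _ ≤ (L.map fun g => 2 * (gapSums g).length).sum :=
        List.sum_le_sum fun g _ => card_offDiag_le g
    _ = 2 * (L.flatMap gapSums).length := by
        rw [List.length_flatMap, List.sum_map_mul_left]

theorem isCDF_gapBlocks {L : List (List (ZMod v))} (hK : ∀ g ∈ L, g.length + 1 ∈ K)
    (hzero : 0 ∉ L.flatMap gapSums)
    (hcover : ∀ d : ZMod v, d ≠ 0 → d ∈ L.flatMap gapSums ∨ -d ∈ L.flatMap gapSums)
    (hcard : 2 * (L.flatMap gapSums).length < v) : IsCDF v K (gapBlocks L) := by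
  have exists_sub_eq {d : ZMod v} (hd : d ∈ L.flatMap gapSums) :
      ∃ B ∈ gapBlocks L, ∃ x ∈ B, ∃ y ∈ B, x - y = d := by
    obtain ⟨g, hg, hdg⟩ := List.mem_flatMap.1 hd
    obtain ⟨x, hx, y, hy, hxy⟩ := exists_add_eq_of_mem_gapSums hdg
    exact ⟨_, mem_gapBlocks.2 ⟨g, hg, rfl⟩, x, List.mem_toFinset.2 hx, y, List.mem_toFinset.2 hy,
      sub_eq_of_eq_add' hxy.symm⟩
  refine isCDF_of_sum_card_offDiag_lt (fun B hB => ?_) (fun d hd => ?_)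
    ((sum_card_offDiag_gapBlocks_le L).trans_lt hcard)
  · obtain ⟨g, hg, rfl⟩ := mem_gapBlocks.1 hB
    have hnodup := nodup_gapPoints fun h => hzero (List.mem_flatMap.2 ⟨g, hg, h⟩)
    rw [List.toFinset_card_of_nodup hnodup, length_gapPoints]
    exact hK g hg
  · rcases hcover d hd with h | h
    · exact exists_sub_eq h
    · obtain ⟨B, hB, x, hx, y, hy, hxy⟩ := exists_sub_eq h
      exact ⟨B, hB, y, hy, x, hx, by rw [← neg_sub, hxy, neg_neg]⟩

end CyclicDifferenceFamilies

section PerfectSystems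

/-- A perfect system of difference sets in the sense of Bermond, Kotzig and Turgeon, starting at
`1`: the positive differences within the blocks are `1, …, n`, each occurring exactly once. The
blocks are given by their gap lists, and `K` is the set of allowed block sizes. -/
structure IsPerfectSystem (n : ℕ) (K : Set ℕ) (L : List (List ℕ)) : Prop where
  length_add_one_mem : ∀ g ∈ L, g.length + 1 ∈ K
  perm : (L.flatMap gapSums).Perm (List.range' 1 n)

variable {n : ℕ} {K : Set ℕ} {L : List (List ℕ)}

theorem exists_natCast_eq_or_natCast_eq_neg {d : ZMod (2 * n + 1)} (hd : d ≠ 0) :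
    ∃ k : ℕ, 1 ≤ k ∧ k ≤ n ∧ ((k : ZMod (2 * n + 1)) = d ∨ (k : ZMod (2 * n + 1)) = -d) := by
  have hle := d.natAbs_valMinAbs_le
  refine ⟨d.valMinAbs.natAbs, by simpa [Nat.one_le_iff_ne_zero] using hd, by lia, ?_⟩
  have hcast := d.natCast_natAbs_valMinAbs
  split_ifs at hcast
  exacts [.inl hcast, .inr hcast]

theorem IsPerfectSystem.exists_isPDF (h : IsPerfectSystem n K L) :
    ∃ F : Finset (Finset (ZMod (2 * n + 1))), IsPDF (2 * n + 1) K F := by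
  let cast : ℕ →+ ZMod (2 * n + 1) := Nat.castAddMonoidHom _
  let M := L.map (List.map cast)
  have sums_perm : (M.flatMap gapSums).Perm ((List.range' 1 n).map cast) :=
    flatMap_gapSums_map cast L ▸ h.perm.map cast
  have mem_sums (d : ZMod (2 * n + 1)) :
      d ∈ M.flatMap gapSums ↔ ∃ k : ℕ, (1 ≤ k ∧ k ≤ n) ∧ (k : ZMod (2 * n + 1)) = d := by
    simp [sums_perm.mem_iff, List.mem_range'_1, cast, Nat.lt_one_add_iff]
  refine ⟨gapBlocks M, isCDF_gapBlocks ?_ ?_ (fun d hd => ?_) ?_, fun B hB => ?_⟩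
  · simpa [M] using h.length_add_one_mem
  · intro h0
    obtain ⟨k, ⟨hk1, hkn⟩, hk⟩ := (mem_sums 0).1 h0
    have := Nat.le_of_dvd hk1 ((ZMod.natCast_eq_zero_iff _ _).1 hk)
    lia
  · obtain ⟨k, hk1, hkn, hk | hk⟩ := exists_natCast_eq_or_natCast_eq_neg hd
    · exact .inl ((mem_sums d).2 ⟨k, ⟨hk1, hkn⟩, hk⟩)
    · exact .inr ((mem_sums (-d)).2 ⟨k, ⟨hk1, hkn⟩, hk⟩)
  · rw [sums_perm.length_eq, List.length_map, List.length_range']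
    lia
  · obtain ⟨g, hg, rfl⟩ := mem_gapBlocks.1 hB
    refine ⟨List.mem_toFinset.2 (zero_mem_gapPoints g), fun b hb hb0 => ?_⟩
    have hsum := (eq_zero_or_mem_gapSums (List.mem_toFinset.1 hb)).resolve_left hb0
    obtain ⟨k, ⟨hk1, hkn⟩, rfl⟩ := (mem_sums b).1 (List.mem_flatMap.2 ⟨g, hg, hsum⟩)
    exact ⟨k, hk1, by lia, rfl⟩

end PerfectSystems

section NestedTriples

/-- The gap lists `[a, b + k - 1], [a + 2, b + k - 2], …, [a + 2 * (k - 1), b]`: the first gap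
climbs in steps of two while the second descends in steps of one, so that their sum climbs in steps
of one. -/
def nest (a b k : ℕ) : List (List ℕ) :=
  (List.range k).map fun j => [a + 2 * j, b + (k - 1 - j)]

theorem length_of_mem_nest {a b k : ℕ} {g : List ℕ} (hg : g ∈ nest a b k) : g.length = 2 := by
  obtain ⟨j, -, rfl⟩ := List.mem_map.1 hg
  rfl

theorem length_flatMap_gapSums_nest (a b k : ℕ) :
    ((nest a b k).flatMap gapSums).length = 3 * k := by
  simp [nest, List.length_flatMap, gapSums, gapPoints, Function.comp_def, mul_comm]

theorem mem_flatMap_gapSums_nest {a b k x : ℕ} :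
    x ∈ (nest a b k).flatMap gapSums ↔
      (a ≤ x ∧ x < a + 2 * k ∧ x % 2 = a % 2) ∨ (b ≤ x ∧ x < b + k) ∨
        (a + b + k ≤ x + 1 ∧ x + 1 < a + b + 2 * k) := by
  have mem_iff : x ∈ (nest a b k).flatMap gapSums ↔ ∃ j < k,
      x = a + 2 * j ∨ x = a + 2 * j + (b + (k - 1 - j)) ∨ x = b + (k - 1 - j) := by
    simp [nest, gapSums, gapPoints]
  rw [mem_iff]
  constructor
  · rintro ⟨j, hj, h⟩
    lia
  · rintro (h | h | h)
    · exact ⟨(x - a) / 2, by lia, by lia⟩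
    · exact ⟨b + k - 1 - x, by lia, by lia⟩
    · exact ⟨x + 1 - (a + b + k), by lia, by lia⟩

end NestedTriples

section AffineFamilies

/-- The value at `t` of the affine function with slope `p.1` and constant term `p.2`. -/
def affineEval (t : ℕ) : ℕ × ℕ →+ ℕ :=
  (AddMonoidHom.mulRight t).coprod (AddMonoidHom.id ℕ)

theorem affineEval_apply (t : ℕ) (p : ℕ × ℕ) : affineEval t p = p.1 * t + p.2 := rfl

/-- The part of the perfect system on `1, …, 12 * t + 48 + r` whose number of blocks grows with
`t`. -/
def nestedTriples (t : ℕ) : List (List ℕ) :=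
  nest 5 (8 * t + 37) (2 * t + 4) ++ nest 6 (5 * t + 25) t ++ nest (2 * t + 14) (4 * t + 19) t

/-- The differences, as affine functions of `t`, that `nestedTriples t` leaves uncovered among
`1, …, 12 * t + 48 + r`. A triple `(a, c, k)` stands for `a * t + c, …, a * t + c + k - 1`. -/
def residualSums (r : ℕ) : List (ℕ × ℕ) :=
  [(2, 6), (2, 8), (2, 10), (2, 12)] ++
    [(0, 1, 4), (4, 13, 6), (5, 19, 6), (6, 25, 5), (7, 30, 2), (8, 32, 5), (10, 41, 4),
      (12, 49, r)].flatMap fun (a, c, k) => (List.range' c k).map (Prod.mk a)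

theorem length_of_mem_nestedTriples {t : ℕ} {g : List ℕ} (hg : g ∈ nestedTriples t) :
    g.length = 2 := by
  simp only [nestedTriples, List.mem_append] at hg
  rcases hg with (hg | hg) | hg <;> exact length_of_mem_nest hg

theorem length_residualSums (r : ℕ) : (residualSums r).length = 36 + r := by
  simp +arith [residualSums]

theorem length_flatMap_gapSums_nestedTriples (t : ℕ) :
    ((nestedTriples t).flatMap gapSums).length = 12 * t + 12 := by
  simp only [nestedTriples, List.flatMap_append, List.length_append, length_flatMap_gapSums_nest]
  ring

theorem mem_map_affineEval_range' {t a c k x : ℕ} :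
    x ∈ ((List.range' c k).map (Prod.mk a)).map (affineEval t) ↔
      a * t + c ≤ x ∧ x < a * t + c + k := by
  simp only [List.map_map, List.mem_map, List.mem_range'_1, Function.comp_apply, affineEval_apply]
  exact ⟨by lia, fun h => ⟨x - a * t, by lia, by lia⟩⟩

theorem range'_subset_residualSums_append_nestedTriples (t r : ℕ) :
    List.range' 1 (12 * t + 48 + r) ⊆
      (residualSums r).map (affineEval t) ++ (nestedTriples t).flatMap gapSums := by
  intro x hx
  rw [List.mem_range'_1] at hx
  simp only [residualSums, nestedTriples, List.flatMap_append, List.mem_append, List.map_append,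
    mem_flatMap_gapSums_nest, List.flatMap_cons, List.flatMap_nil, mem_map_affineEval_range',
    List.map_cons, List.map_nil, List.mem_cons, List.not_mem_nil, affineEval_apply]
  omega

theorem isPerfectSystem_of_perm_residualSums (t : ℕ) {r : ℕ} {K : Set ℕ} (hK : 3 ∈ K)
    {S : List (List (ℕ × ℕ))} (hlen : ∀ g ∈ S, g.length + 1 ∈ K)
    (hS : (S.flatMap gapSums).Perm (residualSums r)) :
    IsPerfectSystem (12 * t + 48 + r) K (S.map (List.map (affineEval t)) ++ nestedTriples t) := by
  refine ⟨fun g hg => ?_, ?_⟩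
  · rcases List.mem_append.1 hg with hg | hg
    · obtain ⟨s, hs, rfl⟩ := List.mem_map.1 hg
      rw [List.length_map]
      exact hlen s hs
    · rwa [length_of_mem_nestedTriples hg]
  · have covers := List.subperm_of_subset List.nodup_range'
      (range'_subset_residualSums_append_nestedTriples t r)
    rw [List.flatMap_append, flatMap_gapSums_map]
    refine ((hS.map _).append_right _).trans (covers.perm_of_length_le ?_).symm
    rw [List.length_append, List.length_map, length_residualSums,
      length_flatMap_gapSums_nestedTriples, List.length_range']
    lia

end AffineFamilies

theorem exists_isPerfectSystem_of_small {n : ℕ} (hn : n ∈ [29, 32, 35, 38, 41, 44, 47]) :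
    ∃ L, IsPerfectSystem n {3, 4, 5} L := by
  fin_cases hn
  · exact ⟨[[1, 14, 5, 8], [7, 4, 6, 12], [2, 21, 3], [9, 16]], by simp, by decide⟩
  · exact ⟨[[5, 1, 12, 7], [3, 11, 15, 2], [4, 23], [8, 16], [9, 21], [10, 22]], by simp, by decide⟩
  · exact ⟨[[9, 8, 12, 3], [6, 5, 14, 2], [1, 33], [4, 26], [7, 24], [10, 18], [13, 22]],
      by simp, by decide⟩
  · exact ⟨[[9, 2, 15, 12], [14, 18, 4, 1], [19, 6, 10], [3, 30], [7, 24], [8, 20], [13, 21]],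
      by simp, by decide⟩
  · exact ⟨[[4, 16, 10, 3], [14, 17, 1, 7], [12, 9, 15], [2, 35], [5, 23], [6, 34], [11, 27],
      [19, 22]], by simp, by decide⟩
  · exact ⟨[[2, 1, 11, 28], [4, 15, 7, 10], [5, 30], [6, 31], [8, 25], [9, 29], [13, 21], [16, 27],
      [18, 23], [20, 24]], by simp, by decide⟩
  · exact ⟨[[17, 5, 8, 7], [2, 1, 24, 16], [4, 34], [6, 26], [9, 36], [10, 29], [11, 31], [12, 35],
      [14, 19], [18, 28], [21, 23]], by simp, by decide⟩

theorem exists_isPerfectSystem_of_large (t : ℕ) {r : ℕ} (hr : r ∈ [2, 5, 8, 11]) :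
    ∃ L, IsPerfectSystem (12 * t + 48 + r) {3, 4, 5} L := by
  suffices ∃ S : List (List (ℕ × ℕ)), (∀ g ∈ S, g.length + 1 ∈ ({3, 4, 5} : Set ℕ)) ∧
      (S.flatMap gapSums).Perm (residualSums r) by
    obtain ⟨S, hlen, hS⟩ := this
    exact ⟨_, isPerfectSystem_of_perm_residualSums t (by simp) hlen hS⟩
  fin_cases hr
  · exact ⟨[[(0, 1), (6, 25), (0, 3), (4, 13)], [(2, 6), (2, 12), (4, 15), (4, 17)],
      [(5, 19), (0, 4), (5, 20)], [(4, 14), (8, 35)], [(2, 10), (5, 21)], [(0, 2), (8, 34)],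
      [(2, 8), (5, 22)]], by simp, by decide⟩
  · exact ⟨[[(2, 6), (6, 27), (0, 2), (4, 14)], [(2, 8), (5, 22), (0, 1), (5, 19)],
      [(2, 10), (6, 26), (4, 15)], [(0, 4), (4, 13)], [(2, 12), (8, 32)], [(4, 18), (8, 34)],
      [(0, 3), (5, 21)], [(6, 25), (6, 28)]], by simp, by decide⟩
  · exact ⟨[[(0, 1), (4, 16), (4, 18), (4, 15)], [(0, 2), (5, 20), (5, 21), (2, 10)],
      [(2, 12), (4, 13)], [(0, 3), (12, 52)], [(6, 27), (6, 29)], [(2, 8), (8, 36)],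
      [(0, 4), (5, 19)], [(4, 14), (6, 28)], [(2, 6), (6, 26)], [(5, 24), (7, 30)]],
      by simp, by decide⟩
  · exact ⟨[[(2, 8), (6, 28), (2, 6), (2, 10)], [(0, 1), (4, 14), (4, 18), (4, 17)],
      [(0, 3), (6, 26), (6, 27)], [(2, 12), (4, 13)], [(0, 4), (12, 54)], [(5, 21), (7, 30)],
      [(5, 20), (5, 23)], [(5, 19), (5, 22)], [(5, 24), (7, 31)], [(0, 2), (12, 57)]],
      by simp, by decide⟩

theorem exists_isPerfectSystem {n : ℕ} (hn : 29 ≤ n) (hmod : n % 3 = 2) :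
    ∃ L, IsPerfectSystem n {3, 4, 5} L := by
  by_cases hsmall : n < 50
  · exact exists_isPerfectSystem_of_small (by simp; lia)
  · obtain ⟨t, r, hr, rfl⟩ : ∃ t r, r ∈ [2, 5, 8, 11] ∧ n = 12 * t + 48 + r :=
      ⟨n / 12 - 4, n % 12, by simp; lia, by lia⟩
    exact exists_isPerfectSystem_of_large t hr

theorem lemma4p3 (v : ℕ) (hmod : v ≡ 5 [MOD 6]) (hv : 59 ≤ v) :
    ∃ F : Finset (Finset (ZMod v)), IsPDF v {3, 4, 5} F := by
  have hv6 : v % 6 = 5 := hmod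
  obtain ⟨n, rfl⟩ : ∃ n, v = 2 * n + 1 := ⟨v / 2, by lia⟩
  obtain ⟨L, hL⟩ := exists_isPerfectSystem (n := n) (by lia) (by lia)
  exact hL.exists_isPDF
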